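/- Let $L>0$, $\Omega=(0,L)$, and for an integer $m\ge 0$ let $H^m_{per}(\Omega)$ be the space of complex-valued $L$-periodic functions whose weak derivatives $\partial^j f$, $0\le j\le m$, belong to $L^2(\Omega)$, with norm $\|f\|_{H^m}=\big(\sum_{j=0}^m\int_\Omega|\partial^jf|^2\,dx\big)^{1/2}$. Let $\alpha,\rho,\sigma,\delta\in\mathbb R$ satisfy $\alpha\rho=\sigma\delta$. Let $\phi_0\in H^3_{per}(\Omega)$, $T>0$, and let $\phi\in C([0,T],H^3_{per}(\Omega))\cap C^1([0,T],L^2(\Omega))$ be a solution of $$\phi_t+3\alpha|\phi|^2\phi_x-\mathrm i\rho\,\phi_{xx}+\sigma\,\phi_{xxx}-\mathrm i\delta|\phi|^2\phi=0,\qquad \phi(0)=\phi_0,$$ the equation being understood in $L^2(\Omega)$ for every $t\in[0,T]$. Put $$J_1(\phi)=\rho\int_\Omega|\phi_{xx}|^2dx-4\delta\int_\Omega|\phi|^2|\phi_x|^2dx-\delta\,\mathrm{Re}\int_\Omega\phi^2\,\overline{\phi}_x^{\,2}\,dx$$ and, with $\phi=\phi(t)$, $$\begin{aligned}E_1(t)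=\;&9\alpha\delta\int_\Omega|\phi|^2|\phi_x|^2(|\phi|^2)_x\,dx-6\alpha\delta\,\mathrm{Re}\int_\Omega|\phi|^2\phi_x\,\overline{\phi}^{\,2}\phi_{xx}\,dx\\&-8\delta\rho\,\mathrm{Im}\int_\Omega|\phi_x|^2\phi\,\overline{\phi}_{xx}\,dx-4\delta\rho\,\mathrm{Im}\int_\Omega|\phi_x|^2\overline{\phi}\,\phi_{xx}\,dx-2\delta\rho\,\mathrm{Im}\int_\Omega\overline{\phi}_x^{\,2}\,\phi\,\phi_{xx}\,dx\\&+6\delta^2\,\mathrm{Im}\int_\Omega|\phi|^4\,\overline{\phi}\,\phi_{xx}\,dx-6\delta^2\,\mathrm{Im}\int_\Omega|\phi|^2\phi^2\,\overline{\phi}_x^{\,2}\,dx.\end{aligned}$$ Then $t\mapsto J_1(\phi(t))$ is differentiable at every $t\in[0,T]$ (one-sidedly at the endpoints), and $$\frac{d}{dt}J_1(\phi(t))=E_1(t)\qquad\text{for every }t\in[0,T].$$ -/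

import Mathlib

open MeasureTheory Set
open scoped ContDiff ComplexConjugate ENNReal

noncomputable section

namespace ENLS

/-- The complex space `L²(Ω)`, `Ω = (0, L)`; its elements are regarded as `L`-periodic functions,
that is, as functions on the circle `ℝ / Lℤ`, whose measure is Lebesgue measure of total mass `L`. -/
abbrev L2per (L : ℝ) [Fact (0 < L)] : Type :=
  Lp ℂ 2 (volume : Measure (AddCircle L))

/-- `g` is the `j`-th weak (distributional) derivative of the periodic function `f`. The test
functions are the smooth periodic functions. -/
def IsWeakDeriv {L : ℝ} [Fact (0 < L)] (j : ℕ) (f g : L2per L) : Prop :=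
  ∀ ψ : AddCircle L → ℂ, ContDiff ℝ ∞ (fun y : ℝ => ψ (y : AddCircle L)) →
    ∫ x in (0 : ℝ)..L, f (x : AddCircle L) * iteratedDeriv j (fun y : ℝ => ψ (y : AddCircle L)) x
      = (-1) ^ j * ∫ x in (0 : ℝ)..L, g (x : AddCircle L) * ψ (x : AddCircle L)

section aux

variable {L : ℝ} [Fact (0 < L)]

theorem intervalIntegrable_mul (f : L2per L) {c : ℝ → ℂ} (hc : Continuous c) :
    IntervalIntegrable (fun x : ℝ => f (x : AddCircle L) * c x) volume 0 L := by
  have hL : (0 : ℝ) < L := Fact.out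
  have h1 : Integrable (fun x : AddCircle L => f x) volume :=
    (Lp.memLp f).integrable (by norm_num)
  have h2 := (AddCircle.measurePreserving_mk L 0).integrable_comp_of_integrable h1
  rw [zero_add] at h2
  have h3 : IntervalIntegrable (fun x : ℝ => f (x : AddCircle L)) volume 0 L :=
    (intervalIntegrable_iff_integrableOn_Ioc_of_le hL.le).2 h2
  exact h3.mul_continuousOn hc.continuousOn

theorem ae_of_circle {p : AddCircle L → Prop} (h : ∀ᵐ x : AddCircle L, p x) :
    ∀ᵐ x : ℝ, x ∈ uIoc 0 L → p (x : AddCircle L) := by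
  have hL : (0 : ℝ) < L := Fact.out
  have h2 := (AddCircle.measurePreserving_mk L 0).quasiMeasurePreserving.ae h
  rw [zero_add] at h2
  rw [uIoc_of_le hL.le]
  exact (ae_restrict_iff' measurableSet_Ioc).1 h2

theorem integral_add_mul (f g : L2per L) {c : ℝ → ℂ} (hc : Continuous c) :
    ∫ x in (0 : ℝ)..L, (f + g : L2per L) (x : AddCircle L) * c x
      = (∫ x in (0 : ℝ)..L, f (x : AddCircle L) * c x)
        + ∫ x in (0 : ℝ)..L, g (x : AddCircle L) * c x := by
  rw [← intervalIntegral.integral_add (intervalIntegrable_mul f hc) (intervalIntegrable_mul g hc)]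
  refine intervalIntegral.integral_congr_ae ?_
  filter_upwards [ae_of_circle (Lp.coeFn_add f g)] with x hx hx'
  rw [hx hx', Pi.add_apply, add_mul]

theorem integral_smul_mul (a : ℂ) (f : L2per L) (c : ℝ → ℂ) :
    ∫ x in (0 : ℝ)..L, (a • f : L2per L) (x : AddCircle L) * c x
      = a * ∫ x in (0 : ℝ)..L, f (x : AddCircle L) * c x := by
  rw [← intervalIntegral.integral_const_mul]
  refine intervalIntegral.integral_congr_ae ?_
  filter_upwards [ae_of_circle (Lp.coeFn_smul a f)] with x hx hx'
  rw [hx hx', Pi.smul_apply, smul_eq_mul, mul_assoc]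

theorem integral_zero_mul (c : ℝ → ℂ) :
    ∫ x in (0 : ℝ)..L, (0 : L2per L) (x : AddCircle L) * c x = 0 := by
  have h := integral_smul_mul 0 (0 : L2per L) c
  rwa [zero_smul, zero_mul] at h

theorem continuous_iteratedDeriv {c : ℝ → ℂ} (hc : ContDiff ℝ ∞ c) (j : ℕ) :
    Continuous (iteratedDeriv j c) :=
  hc.continuous_iteratedDeriv j (by exact_mod_cast le_top)

end aux

/-- The complexified periodic Sobolev space `H^m_per(Ω)`. An element is given by the tuple
`(f, ∂f, …, ∂^m f)` of an `L²` function and its weak derivatives (which `f` determines), so the norm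
inherited from the `ℓ²`-product is `‖f‖ = (∑_{j ≤ m} ∫_Ω |∂^j f|² dx)^{1/2}`. -/
def Hper (L : ℝ) [Fact (0 < L)] (m : ℕ) :
    Submodule ℂ (PiLp 2 (fun _ : Fin (m + 1) => L2per L)) where
  carrier := {f | ∀ j : Fin (m + 1), IsWeakDeriv (j : ℕ) (f 0) (f j)}
  zero_mem' := by
    intro j ψ _
    simp only [PiLp.zero_apply]
    rw [integral_zero_mul, integral_zero_mul, mul_zero]
  add_mem' := by
    intro f g hf hg j ψ hψ
    simp only [PiLp.add_apply]
    rw [integral_add_mul _ _ (continuous_iteratedDeriv hψ j), integral_add_mul _ _ hψ.continuous,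
      hf j ψ hψ, hg j ψ hψ, mul_add]
  smul_mem' := by
    intro a f hf j ψ hψ
    simp only [PiLp.smul_apply]
    rw [integral_smul_mul, integral_smul_mul, hf j ψ hψ, mul_left_comm]

/-- The weak derivative `∂^j f` of `f ∈ H^m_per(Ω)`, `j ≤ m`; `∂^0 f` is `f` as an element of
`L²(Ω)`. -/
def wd {L : ℝ} [Fact (0 < L)] {m : ℕ} (j : Fin (m + 1)) (f : Hper L m) : L2per L :=
  (f : PiLp 2 (fun _ : Fin (m + 1) => L2per L)) j

/-- `φ ∈ C([0,T], H³_per(Ω)) ∩ C¹([0,T], L²(Ω))` solves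
`φ_t + 3α|φ|²φ_x - iρφ_xx + σφ_xxx - iδ|φ|²φ = 0`, `φ(0) = φ₀`, with period `L` in `x`. The time
derivative is the one of the `L²(Ω)`-valued curve and the equation holds in `L²(Ω)`. -/
structure IsSolution {L : ℝ} [Fact (0 < L)] (α ρ σ δ : ℝ) (φ₀ : Hper L 3) (T : ℝ)
    (φ : ℝ → Hper L 3) : Prop where
  continuousOn : ContinuousOn φ (Icc 0 T)
  contDiffOn : ContDiffOn ℝ 1 (fun t => wd 0 (φ t)) (Icc 0 T)
  initial : φ 0 = φ₀
  equation : ∀ t ∈ Icc 0 T, ∀ᵐ x : AddCircle L,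
    derivWithin (fun s => wd 0 (φ s)) (Icc 0 T) t x
      + 3 * (α : ℂ) * (‖wd 0 (φ t) x‖ : ℂ) ^ 2 * wd 1 (φ t) x
      - Complex.I * (ρ : ℂ) * wd 2 (φ t) x
      + (σ : ℂ) * wd 3 (φ t) x
      - Complex.I * (δ : ℂ) * (‖wd 0 (φ t) x‖ : ℂ) ^ 2 * wd 0 (φ t) x = 0

/-- `J₁(φ) = ρ ∫ |φ_xx|² - 4δ ∫ |φ|²|φ_x|² - δ Re ∫ φ² (conj φ_x)²`. -/
def J₁ {L : ℝ} [Fact (0 < L)] (ρ δ : ℝ) (φ : Hper L 3) : ℝ :=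
  ρ * (∫ x : AddCircle L, ‖wd 2 φ x‖ ^ 2)
    - 4 * δ * (∫ x : AddCircle L, ‖wd 0 φ x‖ ^ 2 * ‖wd 1 φ x‖ ^ 2)
    - δ * (∫ x : AddCircle L, wd 0 φ x ^ 2 * conj (wd 1 φ x) ^ 2).re

/-- The right-hand side of the energy equation; in the first integral `(|φ|²)_x` is written as
`2 Re (conj φ * φ_x)`. -/
def E₁ {L : ℝ} [Fact (0 < L)] (α ρ δ : ℝ) (φ : Hper L 3) : ℝ :=
  9 * α * δ * (∫ x : AddCircle L,
      ‖wd 0 φ x‖ ^ 2 * ‖wd 1 φ x‖ ^ 2 * (2 * (conj (wd 0 φ x) * wd 1 φ x).re))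
    - 6 * α * δ * (∫ x : AddCircle L,
      (‖wd 0 φ x‖ : ℂ) ^ 2 * wd 1 φ x * conj (wd 0 φ x) ^ 2 * wd 2 φ x).re
    - 8 * δ * ρ * (∫ x : AddCircle L,
      (‖wd 1 φ x‖ : ℂ) ^ 2 * wd 0 φ x * conj (wd 2 φ x)).im
    - 4 * δ * ρ * (∫ x : AddCircle L,
      (‖wd 1 φ x‖ : ℂ) ^ 2 * conj (wd 0 φ x) * wd 2 φ x).im
    - 2 * δ * ρ * (∫ x : AddCircle L,
      conj (wd 1 φ x) ^ 2 * wd 0 φ x * wd 2 φ x).im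
    + 6 * δ ^ 2 * (∫ x : AddCircle L,
      (‖wd 0 φ x‖ : ℂ) ^ 4 * conj (wd 0 φ x) * wd 2 φ x).im
    - 6 * δ ^ 2 * (∫ x : AddCircle L,
      (‖wd 0 φ x‖ : ℂ) ^ 2 * wd 0 φ x ^ 2 * conj (wd 1 φ x) ^ 2).im

end ENLS

end

noncomputable section

namespace ENLS

/-! ### Absolutely continuous periodic functions -/

/-! With $\phi$ continuous into $H^3$ and differentiable only into $L^2$, $\phi_{xxt}$ is merely a
distribution, so $J_1$ cannot be differentiated under the integral sign. Its terms are treated in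
two ways.

For $\int|\phi_{xx}|^2$, each Fourier coefficient of $\phi$ is differentiable in time. The symbols
of $\mathrm i\rho\partial^2$ and $-\sigma\partial^3$ are imaginary, so the linear part does not
change the moduli; the nonlinear part $N$ contributes the Parseval terms of $-2\,\mathrm{Re}\int
N_x\overline{\phi}_{xxx}$. Integrating in time and summing by dominated convergence justifies the
derivative (`hasDerivWithinAt_norm_sq_of_basis`, `hasDerivWithinAt_integral_sq_wd_two`).

For the quartic terms, the difference of values at $\phi$ and $\psi$ is exactly
$\mathrm{Re}\int(\phi-\psi)K(\phi,\psi)$ after one integration by parts, with $K$ continuous in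
$\phi$ for the sup norm. Differentiability in $L^2$ then suffices
(`hasDerivWithinAt_of_integral_mul`).

The resulting derivative minus $E_1$ is the real part of the integral of an exact $x$-derivative;
$\alpha\rho=\sigma\delta$ is what makes the terms with $\phi_{xxx}$ exact (`energy_identity`).
Because $\phi_{xxx}$ is only $L^2$, all integrations by parts are for absolutely continuous
functions (`HasACDeriv`). -/

theorem integral_deriv_mul_eq_sub_of_primitive_real {F G f g : ℝ → ℝ} {a b : ℝ}
    (hf : IntervalIntegrable f volume a b) (hg : IntervalIntegrable g volume a b)
    (hF : ∀ x, F x - F a = ∫ t in a..x, f t) (hG : ∀ x, G x - G a = ∫ t in a..x, g t) :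
    ∫ x in a..b, (f x * G x + F x * g x) = F b * G b - F a * G a := by
  have hF' : F = fun x => (∫ t in a..x, f t) + F a := by
    funext x; rw [← hF x]; ring
  have hG' : G = fun x => (∫ t in a..x, g t) + G a := by
    funext x; rw [← hG x]; ring
  have key : ∀ (f : ℝ → ℝ) (c : ℝ), IntervalIntegrable f volume a b →
      AbsolutelyContinuousOnInterval (fun x => (∫ t in a..x, f t) + c) a b := by
    intro f c hf
    have h := (hf.absolutelyContinuousOnInterval_intervalIntegral (c := a) left_mem_uIcc)
    have h2 : AbsolutelyContinuousOnInterval (fun _ : ℝ => c) a b :=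
      (contDiffOn_const (n := 1)).absolutelyContinuousOnInterval
    exact h.add h2
  have acF : AbsolutelyContinuousOnInterval F a b := by rw [hF']; exact key f _ hf
  have acG : AbsolutelyContinuousOnInterval G a b := by rw [hG']; exact key g _ hg
  rw [← acF.integral_deriv_mul_eq_sub acG]
  refine intervalIntegral.integral_congr_ae ?_
  filter_upwards [hf.ae_hasDerivAt_integral, hg.ae_hasDerivAt_integral] with x h1 h2 hx
  have hx' : x ∈ uIcc a b := uIoc_subset_uIcc hx
  have e1 : deriv F x = f x := by
    rw [hF']; exact ((h1 hx' a left_mem_uIcc).add_const _).deriv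
  have e2 : deriv G x = g x := by
    rw [hG']; exact ((h2 hx' a left_mem_uIcc).add_const _).deriv
  rw [e1, e2]

/-- The real and imaginary parts of $FG$ are combinations of four products of real primitives, and
the real case applies to each. -/
theorem integral_deriv_mul_eq_sub_of_primitive {F G f g : ℝ → ℂ} {a b : ℝ}
    (hf : ∀ x, IntervalIntegrable f volume a x) (hg : ∀ x, IntervalIntegrable g volume a x)
    (hF : ∀ x, F x - F a = ∫ t in a..x, f t) (hG : ∀ x, G x - G a = ∫ t in a..x, g t) :
    ∫ x in a..b, (f x * G x + F x * g x) = F b * G b - F a * G a := by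
  have re_int : ∀ {h : ℝ → ℂ} {x : ℝ}, IntervalIntegrable h volume a x →
      IntervalIntegrable (fun t => (h t).re) volume a x ∧
      (∫ t in a..x, h t).re = ∫ t in a..x, (h t).re := fun {h x} hh =>
    ⟨⟨Complex.reCLM.integrable_comp hh.1, Complex.reCLM.integrable_comp hh.2⟩,
      (Complex.reCLM.intervalIntegral_comp_comm hh).symm⟩
  have im_int : ∀ {h : ℝ → ℂ} {x : ℝ}, IntervalIntegrable h volume a x →
      IntervalIntegrable (fun t => (h t).im) volume a x ∧
      (∫ t in a..x, h t).im = ∫ t in a..x, (h t).im := fun {h x} hh =>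
    ⟨⟨Complex.imCLM.integrable_comp hh.1, Complex.imCLM.integrable_comp hh.2⟩,
      (Complex.imCLM.intervalIntegral_comp_comm hh).symm⟩
  have contP : ∀ {H h : ℝ → ℂ}, (∀ x, IntervalIntegrable h volume a x) →
      (∀ x, H x - H a = ∫ t in a..x, h t) → Continuous H := by
    intro H h hh hH
    have : H = fun x => (∫ t in a..x, h t) + H a := by funext x; rw [← hH x]; ring
    rw [this]
    refine (intervalIntegral.continuous_primitive (fun x y => ?_) a).add continuous_const
    exact (hh x).symm.trans (hh y)
  have cF := contP hf hF
  have cG := contP hg hG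
  have hFr : ∀ x, (F x).re - (F a).re = ∫ t in a..x, (f t).re := fun x => by
    rw [← (re_int (hf x)).2, ← hF x, Complex.sub_re]
  have hFi : ∀ x, (F x).im - (F a).im = ∫ t in a..x, (f t).im := fun x => by
    rw [← (im_int (hf x)).2, ← hF x, Complex.sub_im]
  have hGr : ∀ x, (G x).re - (G a).re = ∫ t in a..x, (g t).re := fun x => by
    rw [← (re_int (hg x)).2, ← hG x, Complex.sub_re]
  have hGi : ∀ x, (G x).im - (G a).im = ∫ t in a..x, (g t).im := fun x => by
    rw [← (im_int (hg x)).2, ← hG x, Complex.sub_im]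
  have fr := (re_int (hf b)).1
  have fi := (im_int (hf b)).1
  have gr := (re_int (hg b)).1
  have gi := (im_int (hg b)).1
  have cFr : Continuous fun x => (F x).re := Complex.continuous_re.comp cF
  have cFi : Continuous fun x => (F x).im := Complex.continuous_im.comp cF
  have cGr : Continuous fun x => (G x).re := Complex.continuous_re.comp cG
  have cGi : Continuous fun x => (G x).im := Complex.continuous_im.comp cG
  have hint : IntervalIntegrable (fun x => f x * G x + F x * g x) volume a b :=
    ((hf b).mul_continuousOn cG.continuousOn).add ((hg b).continuousOn_mul cF.continuousOn)
  have irr := (fr.mul_continuousOn cGr.continuousOn).add (gr.continuousOn_mul cFr.continuousOn)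
  have iii := (fi.mul_continuousOn cGi.continuousOn).add (gi.continuousOn_mul cFi.continuousOn)
  have iri := (fr.mul_continuousOn cGi.continuousOn).add (gi.continuousOn_mul cFr.continuousOn)
  have iir := (fi.mul_continuousOn cGr.continuousOn).add (gr.continuousOn_mul cFi.continuousOn)
  have rr := integral_deriv_mul_eq_sub_of_primitive_real fr gr hFr hGr
  have ii := integral_deriv_mul_eq_sub_of_primitive_real fi gi hFi hGi
  have ri := integral_deriv_mul_eq_sub_of_primitive_real fr gi hFr hGi
  have ir := integral_deriv_mul_eq_sub_of_primitive_real fi gr hFi hGr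
  apply Complex.ext
  · rw [(re_int hint).2]
    simp only [Complex.sub_re, Complex.mul_re]
    have := (intervalIntegral.integral_sub irr iii).symm
    rw [rr, ii] at this
    rw [show ∀ p q r s : ℝ, p - q - (r - s) = p - r - (q - s) by intros; ring, this]
    refine intervalIntegral.integral_congr fun x _ => ?_
    simp only [Complex.add_re, Complex.mul_re]; ring
  · rw [(im_int hint).2]
    simp only [Complex.sub_im, Complex.mul_im]
    have := (intervalIntegral.integral_add iri iir).symm
    rw [ri, ir] at this
    rw [show ∀ p q r s : ℝ, p + q - (r + s) = p - r + (q - s) by intros; ring, this]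
    refine intervalIntegral.integral_congr fun x _ => ?_
    simp only [Complex.add_im, Complex.mul_im]; ring

variable {L : ℝ} [Fact (0 < L)]

theorem intervalIntegrable_coe {f : AddCircle L → ℂ} (hf : Integrable f) (a b : ℝ) :
    IntervalIntegrable (fun x : ℝ => f (x : AddCircle L)) volume a b := by
  have hL : (0 : ℝ) < L := Fact.out
  have h2 := (AddCircle.measurePreserving_mk L 0).integrable_comp_of_integrable hf
  rw [zero_add] at h2
  have h3 : IntervalIntegrable (fun x : ℝ => f (x : AddCircle L)) volume 0 L :=
    (intervalIntegrable_iff_integrableOn_Ioc_of_le hL.le).2 h2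
  refine Function.Periodic.intervalIntegrable₀ (T := L) (fun x => ?_) hL.ne' h3 a b
  simp

theorem integral_circle_eq (f : AddCircle L → ℂ) :
    ∫ x : AddCircle L, f x = ∫ x in (0 : ℝ)..L, f (x : AddCircle L) := by
  rw [← AddCircle.intervalIntegral_preimage L 0 f, zero_add]

/-- The periodic function `F` is absolutely continuous with (almost everywhere) derivative `f`. -/
structure HasACDeriv (F f : AddCircle L → ℂ) : Prop where
  integrable : Integrable f
  sub_eq : ∀ a b : ℝ, F (b : AddCircle L) - F (a : AddCircle L)
    = ∫ x in a..b, f (x : AddCircle L)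

namespace HasACDeriv

variable {F G f g : AddCircle L → ℂ}

theorem continuous (hF : HasACDeriv F f) : Continuous F := by
  have h : Continuous fun x : ℝ => F (x : AddCircle L) := by
    have : (fun x : ℝ => F (x : AddCircle L))
        = fun x : ℝ => (∫ t in (0 : ℝ)..x, f (t : AddCircle L)) + F ((0 : ℝ) : AddCircle L) := by
      funext x; rw [← hF.sub_eq 0 x]; ring
    rw [this]
    exact (intervalIntegral.continuous_primitive
      (fun x y => intervalIntegrable_coe hF.integrable x y) 0).add continuous_const
  exact (QuotientAddGroup.isQuotientMap_mk _).continuous_iff.2 h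

theorem integral_eq_zero (hF : HasACDeriv F f) : ∫ x : AddCircle L, f x = 0 := by
  rw [integral_circle_eq, ← hF.sub_eq 0 L, AddCircle.coe_period, AddCircle.coe_zero, sub_self]

theorem integrable_mul_continuous {h c : AddCircle L → ℂ} (hh : Integrable h) (hc : Continuous c) :
    Integrable (fun x => h x * c x) := by
  obtain ⟨C, hC⟩ := isCompact_univ.exists_bound_of_continuousOn hc.continuousOn
  exact hh.mul_bdd (c := C) hc.aestronglyMeasurable (.of_forall fun x => hC x (mem_univ x))

theorem mul (hF : HasACDeriv F f) (hG : HasACDeriv G g) :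
    HasACDeriv (fun x => F x * G x) (fun x => f x * G x + F x * g x) where
  integrable := by
    refine (integrable_mul_continuous hF.integrable hG.continuous).add ?_
    simpa only [mul_comm] using integrable_mul_continuous hG.integrable hF.continuous
  sub_eq a b := (integral_deriv_mul_eq_sub_of_primitive
    (F := fun x : ℝ => F (x : AddCircle L)) (G := fun x : ℝ => G (x : AddCircle L))
    (fun x => intervalIntegrable_coe hF.integrable a x)
    (fun x => intervalIntegrable_coe hG.integrable a x)
    (fun x => hF.sub_eq a x) (fun x => hG.sub_eq a x)).symm

theorem add (hF : HasACDeriv F f) (hG : HasACDeriv G g) :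
    HasACDeriv (fun x => F x + G x) (fun x => f x + g x) where
  integrable := hF.integrable.add hG.integrable
  sub_eq a b := by
    rw [intervalIntegral.integral_add (intervalIntegrable_coe hF.integrable a b)
      (intervalIntegrable_coe hG.integrable a b), ← hF.sub_eq, ← hG.sub_eq]
    ring

theorem const_mul (c : ℂ) (hF : HasACDeriv F f) :
    HasACDeriv (fun x => c * F x) (fun x => c * f x) where
  integrable := hF.integrable.const_mul c
  sub_eq a b := by rw [intervalIntegral.integral_const_mul, ← hF.sub_eq, mul_sub]

theorem star (hF : HasACDeriv F f) :
    HasACDeriv (fun x => conj (F x)) (fun x => conj (f x)) where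
  integrable := (Complex.conjCLE : ℂ →L[ℝ] ℂ).integrable_comp hF.integrable
  sub_eq a b := by
    have := (Complex.conjCLE : ℂ →L[ℝ] ℂ).intervalIntegral_comp_comm
      (intervalIntegrable_coe hF.integrable a b)
    rw [← hF.sub_eq] at this
    simpa using this.symm

theorem congr (hF : HasACDeriv F f) {F' f' : AddCircle L → ℂ} (h : ∀ x, F' x = F x)
    (h' : ∀ x, f' x = f x) : HasACDeriv F' f' := by
  obtain rfl : F' = F := funext h
  obtain rfl : f' = f := funext h'
  exact hF

theorem of_hasDerivAt (hf : Continuous f)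
    (h : ∀ x : ℝ, HasDerivAt (fun y : ℝ => F (y : AddCircle L)) (f (x : AddCircle L)) x) :
    HasACDeriv F f where
  integrable := hf.integrable_of_hasCompactSupport
    (HasCompactSupport.of_compactSpace _)
  sub_eq a b := by
    refine (intervalIntegral.integral_eq_sub_of_hasDerivAt (fun x _ => h x) ?_).symm
    exact (hf.comp (AddCircle.continuous_mk' L)).intervalIntegrable a b

end HasACDeriv

/-- The symbol `2πin/L` of the derivative. -/
def freq (L : ℝ) (n : ℤ) : ℂ := 2 * Real.pi * Complex.I * n / L

omit [Fact (0 < L)] in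
theorem freq_neg (n : ℤ) : freq L (-n) = -freq L n := by
  simp only [freq]; push_cast; ring

omit [Fact (0 < L)] in
theorem conj_freq (n : ℤ) : conj (freq L n) = -freq L n := by
  simp only [freq, map_div₀, map_mul, Complex.conj_I, Complex.conj_ofReal, map_intCast,
    Complex.conj_ofNat]
  ring

theorem freq_ne_zero {n : ℤ} (hn : n ≠ 0) : freq L n ≠ 0 := by
  have hL : (0 : ℝ) < L := Fact.out
  have := Real.pi_ne_zero
  simp [freq, hn, hL.ne', this]

theorem hasACDeriv_fourier (n : ℤ) :
    HasACDeriv (L := L) (fun x => fourier n x) (fun x => freq L n * fourier n x) :=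
  .of_hasDerivAt (continuous_const.mul (fourier n).continuous)
    fun x => hasDerivAt_fourier L n x

/-! ### The Fourier basis of `L²(Ω)` -/

/-- The inclusion of the continuous periodic functions into `L²(Ω)`. -/
def toL2 (L : ℝ) [Fact (0 < L)] : C(AddCircle L, ℂ) →L[ℂ] L2per L :=
  ContinuousMap.toLp 2 volume ℂ

theorem coeFn_toL2 (F : C(AddCircle L, ℂ)) : toL2 L F =ᵐ[volume] F :=
  ContinuousMap.coeFn_toLp volume F

theorem toL2_injective : Function.Injective (toL2 L) :=
  ContinuousMap.toLp_injective volume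

theorem inner_toL2 (F : C(AddCircle L, ℂ)) (f : L2per L) :
    inner ℂ (toL2 L F) f = ∫ x : AddCircle L, f x * conj (F x) := by
  rw [L2.inner_def]
  refine integral_congr_ae ?_
  filter_upwards [coeFn_toL2 F] with x hx
  rw [hx, RCLike.inner_apply]

theorem integrable_coe (f : L2per L) : Integrable f :=
  (Lp.memLp f).integrable (by norm_num)

theorem integral_fourier (n : ℤ) :
    ∫ x : AddCircle L, fourier n x = if n = 0 then (L : ℂ) else 0 := by
  have hL : (0 : ℝ) < L := Fact.out
  split_ifs with h
  · subst h
    simp [Measure.real, AddCircle.measure_univ, hL.le]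
  · have h0 := (hasACDeriv_fourier (L := L) n).integral_eq_zero
    rw [integral_const_mul] at h0
    exact (mul_eq_zero.1 h0).resolve_left (freq_ne_zero h)

/-- The circle carries total mass $L$, so an exponential has squared norm $L$; hence the factor
$L^{-1/2}$. -/
theorem orthonormal_exp :
    Orthonormal ℂ fun n : ℤ => ((Real.sqrt L)⁻¹ : ℂ) • toL2 L (fourier n) := by
  have hL : (0 : ℝ) < L := Fact.out
  rw [orthonormal_iff_ite]
  intro i j
  have h : inner ℂ (toL2 L (fourier i)) (toL2 L (fourier j)) = if j - i = 0 then (L : ℂ) else 0 := by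
    rw [inner_toL2, ← integral_fourier]
    refine integral_congr_ae ?_
    filter_upwards [coeFn_toL2 (fourier (T := L) j)] with x hx
    rw [hx, ← fourier_neg, ← fourier_add, sub_eq_add_neg]
  have hs : ((Real.sqrt L : ℝ) : ℂ) * (Real.sqrt L : ℝ) = (L : ℂ) := by
    rw [← Complex.ofReal_mul, Real.mul_self_sqrt hL.le]
  have hs0 : ((Real.sqrt L : ℝ) : ℂ) ≠ 0 := by
    exact_mod_cast (Real.sqrt_pos.2 hL).ne'
  rw [inner_smul_left, inner_smul_right, h]
  by_cases hij : i = j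
  · subst hij
    simp only [sub_self, if_true, map_inv₀, Complex.conj_ofReal]
    rw [← hs]; field_simp
  · have : ¬ j - i = 0 := fun h => hij (sub_eq_zero.1 h).symm
    simp [this, hij]

/-- Trigonometric polynomials are uniformly dense in the continuous functions, which are dense in
$L^2$. -/
theorem span_exp_closure_eq_top :
    ⊤ ≤ (Submodule.span ℂ (range fun n : ℤ =>
      ((Real.sqrt L)⁻¹ : ℂ) • toL2 L (fourier n))).topologicalClosure := by
  have hL : (0 : ℝ) < L := Fact.out
  have hs0 : ((Real.sqrt L : ℝ) : ℂ) ≠ 0 := by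
    exact_mod_cast (Real.sqrt_pos.2 hL).ne'
  have h := (ContinuousMap.toLp_denseRange ℂ (volume : Measure (AddCircle L)) ℂ
    (p := 2) (by norm_num)).topologicalClosure_map_submodule span_fourier_closure_eq_top
  rw [← h]
  refine Submodule.topologicalClosure_mono ?_
  rw [Submodule.map_span, Submodule.span_le]
  rintro _ ⟨_, ⟨n, rfl⟩, rfl⟩
  have : toL2 L (fourier n)
      = (Real.sqrt L : ℂ) • (((Real.sqrt L)⁻¹ : ℂ) • toL2 L (fourier n)) := by
    rw [smul_smul, mul_inv_cancel₀ hs0, one_smul]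
  change toL2 L (fourier n) ∈ _
  rw [this]
  exact Submodule.smul_mem _ _ (Submodule.subset_span ⟨n, rfl⟩)

/-- The orthonormal basis of exponentials of `L²(Ω)`. -/
def expBasis (L : ℝ) [Fact (0 < L)] : HilbertBasis ℤ ℂ (L2per L) :=
  HilbertBasis.mk orthonormal_exp span_exp_closure_eq_top

/-- The (unnormalised) Fourier coefficients. -/
def coef (f : L2per L) (n : ℤ) : ℂ := ∫ x : AddCircle L, f x * fourier (-n) x

theorem inner_expBasis (f : L2per L) (n : ℤ) :
    inner ℂ (expBasis L n) f = ((Real.sqrt L)⁻¹ : ℂ) * coef f n := by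
  rw [expBasis, HilbertBasis.coe_mk, inner_smul_left, inner_toL2, coef, map_inv₀,
    Complex.conj_ofReal]
  simp only [fourier_neg]

theorem coef_injective {f g : L2per L} (h : ∀ n, coef f n = coef g n) : f = g := by
  refine (expBasis L).repr.injective ?_
  ext n
  rw [HilbertBasis.repr_apply_apply, HilbertBasis.repr_apply_apply, inner_expBasis,
    inner_expBasis, h]

theorem coef_toL2 (F : C(AddCircle L, ℂ)) (n : ℤ) :
    coef (toL2 L F) n = ∫ x : AddCircle L, F x * fourier (-n) x := by
  refine integral_congr_ae ?_
  filter_upwards [coeFn_toL2 F] with x hx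
  rw [hx]

theorem coef_eq_inner (f : L2per L) (n : ℤ) : coef f n = inner ℂ (toL2 L (fourier n)) f := by
  rw [inner_toL2]; simp only [coef, fourier_neg]

theorem coef_add (f g : L2per L) (n : ℤ) : coef (f + g) n = coef f n + coef g n := by
  simp only [coef_eq_inner, inner_add_right]

theorem coef_smul (c : ℂ) (f : L2per L) (n : ℤ) : coef (c • f) n = c * coef f n := by
  simp only [coef_eq_inner, inner_smul_right]

/-- The derivative of the periodic product $F e_{-n}$ has integral zero. -/
theorem integral_deriv_mul_fourier {F g : AddCircle L → ℂ} (hF : HasACDeriv F g) (n : ℤ) :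
    ∫ x : AddCircle L, g x * fourier (-n) x
      = freq L n * ∫ x : AddCircle L, F x * fourier (-n) x := by
  have h := (hF.mul (hasACDeriv_fourier (L := L) (-n))).integral_eq_zero
  have i1 : Integrable fun x : AddCircle L => g x * fourier (-n) x :=
    HasACDeriv.integrable_mul_continuous hF.integrable (fourier (-n)).continuous
  have i2 : Integrable fun x : AddCircle L => F x * (freq L (-n) * fourier (-n) x) :=
    (hF.continuous.mul (continuous_const.mul (fourier (-n)).continuous)).integrable_of_hasCompactSupport
      (.of_compactSpace _)
  rw [integral_add i1 i2, freq_neg] at h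
  rw [eq_neg_of_add_eq_zero_left h, ← integral_const_mul, ← integral_neg]
  refine integral_congr_ae (.of_forall fun x => ?_)
  simp only; ring

/-! ### Continuous representatives -/

theorem exists_hasACDeriv_of_integral_eq_zero {g : AddCircle L → ℂ} (hg : Integrable g)
    (h0 : ∫ x : AddCircle L, g x = 0) : ∃ F : AddCircle L → ℂ, HasACDeriv F g := by
  have hp : Function.Periodic (fun x : ℝ => ∫ t in (0 : ℝ)..x, g (t : AddCircle L)) L := by
    intro x
    simp only
    rw [← intervalIntegral.integral_add_adjacent_intervals (intervalIntegrable_coe hg 0 x)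
      (intervalIntegrable_coe hg x (x + L)), AddCircle.intervalIntegral_preimage L x g, h0,
      add_zero]
  refine ⟨hp.lift, hg, fun a b => ?_⟩
  rw [Function.Periodic.lift_coe, Function.Periodic.lift_coe]
  exact intervalIntegral.integral_interval_sub_left (intervalIntegrable_coe hg 0 b)
    (intervalIntegrable_coe hg 0 a)

/-- The case $n=0$ says that $g$ has mean zero, so its primitive is periodic. A constant adjusts the
zeroth coefficient; the others agree by integration by parts, since `freq L n` is nonzero for
$n\ne0$. -/
theorem exists_continuous_rep {f g : L2per L} (h : ∀ n, coef g n = freq L n * coef f n) :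
    ∃ F : C(AddCircle L, ℂ), toL2 L F = f ∧ HasACDeriv F g := by
  have hL : (0 : ℝ) < L := Fact.out
  obtain ⟨F₀, hF₀⟩ := exists_hasACDeriv_of_integral_eq_zero (integrable_coe g) (by
    have := h 0
    simpa [coef, freq] using this)
  set c : ℂ := (L : ℂ)⁻¹ * (coef f 0 - ∫ x : AddCircle L, F₀ x)
  have hF : HasACDeriv (fun x => F₀ x + c) g :=
    ⟨hF₀.integrable, fun a b => by rw [← hF₀.sub_eq]; ring⟩
  refine ⟨⟨fun x => F₀ x + c, hF.continuous⟩, coef_injective fun n => ?_, hF⟩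
  rw [coef_toL2]
  simp only [ContinuousMap.coe_mk]
  by_cases hn : n = 0
  · subst hn
    have i1 : Integrable F₀ := hF₀.continuous.integrable_of_hasCompactSupport (.of_compactSpace _)
    simp only [neg_zero, fourier_zero, mul_one]
    rw [integral_add i1 (integrable_const c)]
    have hL' : (L : ℂ) ≠ 0 := by exact_mod_cast hL.ne'
    simp [Measure.real, AddCircle.measure_univ, hL.le, c]
    field_simp
    ring
  · have h1 := integral_deriv_mul_fourier hF n
    have h2 := h n
    rw [coef] at h2
    rw [h2] at h1
    exact (mul_left_cancel₀ (freq_ne_zero hn) h1).symm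

/-! ### The sup-norm bound by the $L^2$ norms of a function and its derivative. -/

theorem integral_norm_le (f : L2per L) : ∫ x : AddCircle L, ‖f x‖ ≤ Real.sqrt L * ‖f‖ := by
  have hL : (0 : ℝ) < L := Fact.out
  have h := eLpNorm_le_eLpNorm_mul_rpow_measure_univ (p := 1) (q := 2) (by norm_num)
    (Lp.aestronglyMeasurable f)
  have h2 := ENNReal.toReal_mono (by
    refine ENNReal.mul_ne_top (Lp.eLpNorm_ne_top f) (ENNReal.rpow_ne_top_of_nonneg (by norm_num) ?_)
    rw [AddCircle.measure_univ]; exact ENNReal.ofReal_ne_top) h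
  rw [ENNReal.toReal_mul, ← Lp.norm_def, AddCircle.measure_univ, ← ENNReal.toReal_rpow,
    ENNReal.toReal_ofReal hL.le] at h2
  rw [integral_norm_eq_lintegral_enorm (Lp.aestronglyMeasurable f), ← eLpNorm_one_eq_lintegral_enorm,
    Real.sqrt_eq_rpow, mul_comm]
  convert h2 using 3
  norm_num

theorem norm_sub_le_of_hasACDeriv {F g : AddCircle L → ℂ} (hF : HasACDeriv F g)
    (x y : AddCircle L) : ‖F x - F y‖ ≤ ∫ z : AddCircle L, ‖g z‖ := by
  have hL : (0 : ℝ) < L := Fact.out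
  -- Both points are lifted to one period, so the segment between the lifts covers no part of the
  -- circle twice.
  obtain ⟨b, hb, rfl⟩ : ∃ b ∈ Ico 0 (0 + L), (b : AddCircle L) = x :=
    ⟨_, (AddCircle.equivIco L 0 x).2, AddCircle.coe_equivIco⟩
  obtain ⟨a, ha, rfl⟩ : ∃ a ∈ Ico 0 (0 + L), (a : AddCircle L) = y :=
    ⟨_, (AddCircle.equivIco L 0 y).2, AddCircle.coe_equivIco⟩
  rw [zero_add] at ha hb
  rw [hF.sub_eq]
  refine intervalIntegral.norm_integral_le_integral_norm_uIoc.trans ?_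
  have h3 := intervalIntegral.integral_of_le (μ := volume) (f := fun x : ℝ => ‖g (x : AddCircle L)‖) hL.le
  have h4 := AddCircle.intervalIntegral_preimage L 0 fun x => ‖g x‖
  rw [zero_add] at h4
  rw [← h4, h3]
  refine setIntegral_mono_set ?_ (.of_forall fun _ => norm_nonneg _) ?_
  · exact ((intervalIntegrable_iff_integrableOn_Ioc_of_le hL.le).1
      (intervalIntegrable_coe hF.integrable 0 L)).norm
  · refine LE.le.eventuallyLE ?_
    rw [uIoc]
    exact Ioc_subset_Ioc (le_min ha.1 hb.1) (max_le ha.2.le hb.2.le)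

/-- $F(x)$ is its mean plus the average over $y$ of $F(x)-F(y)$; the oscillation is at most
$\int|g|$. -/
theorem norm_le_of_hasACDeriv {F : C(AddCircle L, ℂ)} {g : L2per L} (hF : HasACDeriv F g) :
    ‖F‖ ≤ Real.sqrt L * ‖g‖ + L⁻¹ * (Real.sqrt L * ‖toL2 L F‖) := by
  have hL : (0 : ℝ) < L := Fact.out
  refine (ContinuousMap.norm_le _ (by positivity)).2 fun x => ?_
  have i1 : Integrable fun y : AddCircle L => F y :=
    F.continuous.integrable_of_hasCompactSupport (.of_compactSpace _)
  have e : ∫ y : AddCircle L, (F x - F y) = L * F x - ∫ y : AddCircle L, F y := by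
    rw [integral_sub (integrable_const _) i1]
    simp [Measure.real, AddCircle.measure_univ, hL.le]
  have h1 : ‖∫ y : AddCircle L, (F x - F y)‖ ≤ (Real.sqrt L * ‖g‖) * L := by
    have := norm_integral_le_of_norm_le_const (μ := (volume : Measure (AddCircle L)))
      (.of_forall fun y => (norm_sub_le_of_hasACDeriv hF x y).trans (integral_norm_le g))
    simpa [Measure.real, AddCircle.measure_univ, hL.le] using this
  have h2 : ‖∫ y : AddCircle L, F y‖ ≤ Real.sqrt L * ‖toL2 L F‖ := by
    refine (norm_integral_le_integral_norm _).trans (le_trans (le_of_eq ?_) (integral_norm_le _))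
    refine integral_congr_ae ?_
    filter_upwards [coeFn_toL2 F] with y hy
    rw [hy]
  have h3 : L * ‖F x‖ ≤ (Real.sqrt L * ‖g‖) * L + Real.sqrt L * ‖toL2 L F‖ := by
    have : (L : ℂ) * F x = (∫ y : AddCircle L, (F x - F y)) + ∫ y : AddCircle L, F y := by
      rw [e]; ring
    calc L * ‖F x‖ = ‖(L : ℂ) * F x‖ := by simp [abs_of_pos hL]
      _ ≤ _ := by rw [this]; exact (norm_add_le _ _).trans (add_le_add h1 h2)
  have h4 : ‖F x‖ = L⁻¹ * (L * ‖F x‖) := by field_simp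
  rw [h4]
  refine (mul_le_mul_of_nonneg_left h3 (by positivity)).trans (le_of_eq ?_)
  field_simp

/-! ### Fourier coefficients and continuous representatives of weak derivatives. -/

omit [Fact (0 < L)] in
theorem iteratedDeriv_fourier (n : ℤ) (j : ℕ) :
    iteratedDeriv j (fun y : ℝ => fourier n (y : AddCircle L))
      = fun y : ℝ => freq L n ^ j * fourier n (y : AddCircle L) := by
  induction j with
  | zero => simp
  | succ j ih =>
    rw [iteratedDeriv_succ, ih]
    funext y
    have := (hasDerivAt_fourier L n y).const_mul (freq L n ^ j)
    rw [this.deriv, freq]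
    ring

omit [Fact (0 < L)] in
theorem contDiff_fourier (n : ℤ) :
    ContDiff ℝ ∞ (fun y : ℝ => fourier n (y : AddCircle L)) := by
  simp_rw [fourier_coe_apply]
  exact ((contDiff_const.mul Complex.ofRealCLM.contDiff).div_const _).cexp

theorem coef_wd {m : ℕ} (φ : Hper L m) (j : Fin (m + 1)) (n : ℤ) :
    coef (wd j φ) n = freq L n ^ (j : ℕ) * coef (wd 0 φ) n := by
  have h := φ.2 j (fun x => fourier (-n) x) (contDiff_fourier (-n))
  -- The sign from the symbol of $e_{-n}$ cancels the $(-1)^j$ in the definition of the weak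
  -- derivative.
  rw [iteratedDeriv_fourier, freq_neg, neg_pow] at h
  have h2 : ∀ f : L2per L, coef f n
      = ∫ x in (0 : ℝ)..L, f (x : AddCircle L) * fourier (-n) (x : AddCircle L) :=
    fun f => integral_circle_eq _
  rw [h2, h2]
  have h1 : ((-1 : ℂ) ^ (j : ℕ)) ≠ 0 := by simp
  refine mul_left_cancel₀ h1 (Eq.trans h.symm ?_)
  rw [← intervalIntegral.integral_const_mul, ← intervalIntegral.integral_const_mul]
  refine intervalIntegral.integral_congr fun x _ => ?_
  simp only [wd]; ring

theorem exists_rep {m : ℕ} (φ : Hper L (m + 1)) (j : Fin (m + 1)) :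
    ∃ F : C(AddCircle L, ℂ), toL2 L F = wd j.castSucc φ ∧ HasACDeriv F (wd j.succ φ) := by
  refine exists_continuous_rep fun n => ?_
  rw [coef_wd, coef_wd φ j.castSucc, Fin.val_succ, Fin.val_castSucc]; ring

/-- The continuous representative of the weak derivative `∂^j φ`, `j ≤ m`, of
`φ ∈ H^{m+1}_per(Ω)`. -/
def rep {m : ℕ} (j : Fin (m + 1)) (φ : Hper L (m + 1)) : C(AddCircle L, ℂ) :=
  (exists_rep φ j).choose

theorem toL2_rep {m : ℕ} (j : Fin (m + 1)) (φ : Hper L (m + 1)) :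
    toL2 L (rep j φ) = wd j.castSucc φ :=
  (exists_rep φ j).choose_spec.1

theorem hasACDeriv_rep {m : ℕ} (j : Fin (m + 1)) (φ : Hper L (m + 1)) :
    HasACDeriv (rep j φ) (wd j.succ φ) :=
  (exists_rep φ j).choose_spec.2

theorem wd_ae_eq_rep {m : ℕ} (j : Fin (m + 1)) (φ : Hper L (m + 1)) :
    wd j.castSucc φ =ᵐ[volume] rep j φ := by
  rw [← toL2_rep]; exact coeFn_toL2 _

theorem hasACDeriv_rep_rep {m : ℕ} (j : Fin (m + 1)) (φ : Hper L (m + 2)) :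
    HasACDeriv (rep j.castSucc φ) (rep j.succ φ) := by
  have h := hasACDeriv_rep j.castSucc φ
  have e : wd j.castSucc.succ φ =ᵐ[volume] rep j.succ φ := wd_ae_eq_rep j.succ φ
  refine ⟨h.integrable.congr e, fun a b => ?_⟩
  rw [h.sub_eq]
  -- Almost everywhere equality on the circle lifts to one period at a time; the countably many
  -- periods $(kL,kL+L]$ cover $\mathbb R$.
  have key : ∀ c : ℝ, ∀ᵐ x : ℝ, x ∈ Ioc c (c + L) →
      wd j.castSucc.succ φ (x : AddCircle L) = rep j.succ φ (x : AddCircle L) := fun c =>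
    (ae_restrict_iff' measurableSet_Ioc).1
      ((AddCircle.measurePreserving_mk L c).quasiMeasurePreserving.ae e)
  refine intervalIntegral.integral_congr_ae ?_
  have hL : (0 : ℝ) < L := Fact.out
  filter_upwards [ae_all_iff.2 fun k : ℤ => key (k * L)] with x hx _
  obtain ⟨k, hk, -⟩ := existsUnique_sub_zsmul_mem_Ioc hL x 0
  refine hx k ⟨?_, ?_⟩
  · have := hk.1; simp at this; linarith
  · have := hk.2; simp at this; linarith

theorem norm_wd_le {m : ℕ} (j : Fin (m + 1)) (φ : Hper L m) : ‖wd j φ‖ ≤ ‖φ‖ :=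
  PiLp.norm_apply_le (φ : PiLp 2 (fun _ : Fin (m + 1) => L2per L)) j

theorem continuous_wd {m : ℕ} (j : Fin (m + 1)) :
    Continuous (wd j : Hper L m → L2per L) :=
  (PiLp.continuous_apply 2 _ j).comp continuous_subtype_val

theorem rep_sub {m : ℕ} (j : Fin (m + 1)) (φ ψ : Hper L (m + 1)) :
    rep j (φ - ψ) = rep j φ - rep j ψ := by
  apply toL2_injective
  rw [map_sub, toL2_rep, toL2_rep, toL2_rep]
  rfl

/-- Linearity and the sup-norm bound make this map Lipschitz, so $\phi,\phi_x,\phi_{xx}$ vary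
uniformly continuously in $x$-sup norm with $\phi\in H^3$. -/
theorem continuous_rep {m : ℕ} (j : Fin (m + 1)) :
    Continuous (rep j : Hper L (m + 1) → C(AddCircle L, ℂ)) := by
  have hL : (0 : ℝ) < L := Fact.out
  have hK : 0 ≤ Real.sqrt L + L⁻¹ * Real.sqrt L := by positivity
  refine (LipschitzWith.of_dist_le_mul (K := ⟨_, hK⟩) fun φ ψ => ?_).continuous
  rw [dist_eq_norm, dist_eq_norm, ← rep_sub]
  refine (norm_le_of_hasACDeriv (hasACDeriv_rep j (φ - ψ))).trans ?_
  rw [toL2_rep]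
  have h1 := norm_wd_le j.succ (φ - ψ)
  have h2 := norm_wd_le j.castSucc (φ - ψ)
  change _ ≤ (Real.sqrt L + L⁻¹ * Real.sqrt L) * ‖φ - ψ‖
  calc _ ≤ Real.sqrt L * ‖φ - ψ‖ + L⁻¹ * (Real.sqrt L * ‖φ - ψ‖) := by gcongr
    _ = _ := by ring

/-! ### Differentiating along Fourier coefficients -/

theorem hasSum_norm_sq_inner {ι H : Type*} [NormedAddCommGroup H] [InnerProductSpace ℂ H]
    (b : HilbertBasis ι ℂ H) (v : H) : HasSum (fun k => ‖inner ℂ (b k) v‖ ^ 2) (‖v‖ ^ 2) := by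
  have h := Complex.hasSum_re (b.hasSum_inner_mul_inner v v)
  rw [inner_self_eq_norm_sq_to_K] at h
  convert! h using 1
  · funext k
    rw [← inner_conj_symm v (b k), Complex.conj_mul']
    norm_cast
  · norm_cast

/-- If the squared moduli of all coefficients of `w` are differentiable and the derivatives are
the terms of the Parseval series of `Re ⟪x, y⟫`, then `‖w‖²` has derivative `Re ⟪x, y⟫`. -/
theorem hasDerivWithinAt_norm_sq_of_basis {ι H : Type*} [Countable ι] [NormedAddCommGroup H]
    [InnerProductSpace ℂ H] (b : HilbertBasis ι ℂ H) {w x y : ℝ → H} {T : ℝ}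
    (hx : ContinuousOn x (Icc 0 T)) (hy : ContinuousOn y (Icc 0 T))
    (hw : ∀ k, ∀ t ∈ Icc 0 T, HasDerivWithinAt (fun s => ‖inner ℂ (b k) (w s)‖ ^ 2)
      (inner ℂ (x t) (b k) * inner ℂ (b k) (y t)).re (Icc 0 T) t) :
    ∀ t ∈ Icc 0 T, HasDerivWithinAt (fun s => ‖w s‖ ^ 2) (inner ℂ (x t) (y t)).re (Icc 0 T) t := by
  have ca : ContinuousOn (fun t => (inner ℂ (x t) (y t)).re) (Icc 0 T) :=
    Complex.continuous_re.comp_continuousOn (hx.inner hy)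
  have cak : ∀ k, ContinuousOn
      (fun t => (inner ℂ (x t) (b k) * inner ℂ (b k) (y t)).re) (Icc 0 T) := fun k =>
    Complex.continuous_re.comp_continuousOn
      ((hx.inner continuousOn_const).mul (continuousOn_const.inner hy))
  -- The integrated form is proved first, term by term. The terms are dominated by
  -- $|x_k|^2+|y_k|^2$, whose sum is continuous in time.
  have key : ∀ t ∈ Icc 0 T,
      ‖w t‖ ^ 2 - ‖w 0‖ ^ 2 = ∫ s in (0 : ℝ)..t, (inner ℂ (x s) (y s)).re := by
    intro t ht
    have hsub : Icc 0 t ⊆ Icc 0 T := Icc_subset_Icc le_rfl ht.2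
    have hsub' : uIcc 0 t ⊆ Icc 0 T := by rwa [uIcc_of_le ht.1]
    have hterm : ∀ k, ‖inner ℂ (b k) (w t)‖ ^ 2 - ‖inner ℂ (b k) (w 0)‖ ^ 2
        = ∫ s in (0 : ℝ)..t, (inner ℂ (x s) (b k) * inner ℂ (b k) (y s)).re := by
      intro k
      refine (intervalIntegral.integral_eq_sub_of_hasDerivAt_of_le ht.1
        (fun s hs => ((hw k s (hsub hs)).continuousWithinAt).mono hsub) (fun s hs => ?_)
        ((cak k).mono hsub').intervalIntegrable).symm
      exact (hw k s (hsub (Ioo_subset_Icc_self hs))).hasDerivAt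
        (Icc_mem_nhds hs.1 (hs.2.trans_le ht.2))
    have hb : ∀ s, HasSum (fun k => ‖inner ℂ (b k) (x s)‖ ^ 2 + ‖inner ℂ (b k) (y s)‖ ^ 2)
        (‖x s‖ ^ 2 + ‖y s‖ ^ 2) := fun s =>
      (hasSum_norm_sq_inner b _).add (hasSum_norm_sq_inner b _)
    have h1 := intervalIntegral.hasSum_integral_of_dominated_convergence (μ := volume)
      (a := 0) (b := t)
      (F := fun k s => (inner ℂ (x s) (b k) * inner ℂ (b k) (y s)).re)
      (f := fun s => (inner ℂ (x s) (y s)).re)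
      (fun k s => ‖inner ℂ (b k) (x s)‖ ^ 2 + ‖inner ℂ (b k) (y s)‖ ^ 2)
      (fun k => (((cak k).mono hsub').intervalIntegrable (μ := volume)).aestronglyMeasurable_restrict_uIoc)
      (fun k => .of_forall fun s _ => by
        refine (Complex.abs_re_le_norm _).trans ?_
        rw [norm_mul, norm_inner_symm]
        nlinarith [sq_nonneg (‖inner ℂ (b k) (x s)‖ - ‖inner ℂ (b k) (y s)‖),
          sq_nonneg ‖inner ℂ (b k) (x s)‖, sq_nonneg ‖inner ℂ (b k) (y s)‖])
      (.of_forall fun s _ => (hb s).summable)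
      (by
        simp_rw [fun s => (hb s).tsum_eq]
        exact ((hx.norm.pow 2).add (hy.norm.pow 2)).mono hsub' |>.intervalIntegrable)
      (.of_forall fun s _ => Complex.hasSum_re (b.hasSum_inner_mul_inner (x s) (y s)))
    have h2 := (hasSum_norm_sq_inner b (w t)).sub (hasSum_norm_sq_inner b (w 0))
    simp_rw [hterm] at h2
    exact h2.unique h1
  intro t ht
  have hT : (0 : ℝ) ≤ T := ht.1.trans ht.2
  -- Extending the integrand continuously to $\mathbb R$ lets the fundamental theorem cover the
  -- endpoints as well.
  set A : ℝ → ℝ := IccExtend hT ((Icc 0 T).domRestrict fun t => (inner ℂ (x t) (y t)).re)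
  have cA : Continuous A := ca.domRestrict.Icc_extend'
  have eA : ∀ s ∈ Icc 0 T, A s = (inner ℂ (x s) (y s)).re := fun s hs =>
    IccExtend_of_mem hT _ hs
  have hd : HasDerivAt (fun s => ‖w 0‖ ^ 2 + ∫ r in (0 : ℝ)..s, A r) (A t) t :=
    (cA.integral_hasStrictDerivAt 0 t).hasDerivAt.const_add _
  rw [eA t ht] at hd
  refine hd.hasDerivWithinAt.congr_of_mem (fun s hs => ?_) ht
  have : ∫ r in (0 : ℝ)..s, A r = ∫ r in (0 : ℝ)..s, (inner ℂ (x r) (y r)).re := by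
    refine intervalIntegral.integral_congr fun r hr => eA r ?_
    rw [uIcc_of_le hs.1] at hr
    exact ⟨hr.1, hr.2.trans hs.2⟩
  rw [this, ← key s hs]; ring

theorem norm_sq_eq_integral (f : L2per L) : ‖f‖ ^ 2 = ∫ x : AddCircle L, ‖f x‖ ^ 2 := by
  have h : (inner ℂ f f : ℂ) = ((∫ x : AddCircle L, ‖f x‖ ^ 2 : ℝ) : ℂ) := by
    rw [L2.inner_def, ← integral_complex_ofReal]
    refine integral_congr_ae (.of_forall fun x => ?_)
    simp only [RCLike.inner_apply, Complex.mul_conj', Complex.ofReal_pow]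
  rw [inner_self_eq_norm_sq_to_K] at h
  exact Complex.ofReal_injective (by rw [← h]; push_cast; rfl)

/-- The energy identity for `∫ |φ_xx|²`, where `φ_t = N + iρ φ_xx - σ φ_xxx`. -/
theorem hasDerivWithinAt_integral_sq_wd_two {φ : ℝ → Hper L 3} {N N' : ℝ → C(AddCircle L, ℂ)}
    {ρ σ T : ℝ} (hφ : ContinuousOn φ (Icc 0 T)) (hN' : ContinuousOn N' (Icc 0 T))
    (hN : ∀ t, HasACDeriv (N t) (N' t))
    (h : ∀ t ∈ Icc 0 T, HasDerivWithinAt (fun s => wd 0 (φ s))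
      (toL2 L (N t) + (Complex.I * ρ) • wd 2 (φ t) + (-σ : ℂ) • wd 3 (φ t)) (Icc 0 T) t) :
    ∀ t ∈ Icc 0 T, HasDerivWithinAt (fun s => ∫ x : AddCircle L, ‖wd 2 (φ s) x‖ ^ 2)
      (-2 * (∫ x : AddCircle L, N' t x * conj (wd 3 (φ t) x)).re) (Icc 0 T) t := by
  have c3 : ContinuousOn (fun t => (-2 : ℂ) • wd 3 (φ t)) (Icc 0 T) :=
    ((continuous_wd 3).comp_continuousOn hφ).const_smul (-2 : ℂ)
  have cN : ContinuousOn (fun t => toL2 L (N' t)) (Icc 0 T) :=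
    (toL2 L).continuous.comp_continuousOn hN'
  -- The formal derivative $2\,\mathrm{Re}\langle\phi_{xx},N_{xx}\rangle$ is used in the form
  -- $\mathrm{Re}\langle-2\phi_{xxx},N_x\rangle$, which needs one derivative of $N$ only.
  have main := hasDerivWithinAt_norm_sq_of_basis (expBasis L) (w := fun t => wd 2 (φ t)) c3 cN ?_
  · intro t ht
    have := main t ht
    simp only [norm_sq_eq_integral] at this
    convert! this using 1
    rw [inner_smul_left, ← inner_conj_symm, inner_toL2, ← integral_conj]
    simp [mul_comm]
  · intro k t ht
    set f := freq L k
    have hf : conj f = -f := conj_freq k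
    set c : ℂ := ((Real.sqrt L)⁻¹ : ℂ)
    have hc : conj c = c := by simp [c]
    have e1 : ∀ s, inner ℂ (expBasis L k) (wd 2 (φ s)) = c * f ^ 2 * coef (wd 0 (φ s)) k := by
      intro s
      rw [inner_expBasis, coef_wd]
      simp [f, c]; ring
    have d0 : HasDerivWithinAt (fun s => coef (wd 0 (φ s)) k)
        (coef (toL2 L (N t)) k + Complex.I * ρ * coef (wd 2 (φ t)) k
          + (-σ) * coef (wd 3 (φ t)) k) (Icc 0 T) t := by
      have := (hasDerivWithinAt_const t (Icc 0 T) (toL2 L (fourier k))).inner ℂ (h t ht)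
      simp only [inner_zero_left, add_zero] at this
      simpa only [← coef_eq_inner, coef_add, coef_smul] using this
    have d1 := (d0.const_mul (c * f ^ 2)).norm_sq
    simp only [e1]
    convert! d1 using 1
    rw [← inner_conj_symm ((-2 : ℂ) • wd 3 (φ t)), inner_smul_right, inner_expBasis,
      inner_expBasis, coef_toL2, integral_deriv_mul_fourier (hN t), ← coef_toL2, coef_wd _ 3, coef_wd _ 2, Complex.inner]
    set z := coef (wd 0 (φ t)) k
    set n := coef (toL2 L (N t)) k
    -- As $\bar f=-f$, both $\mathrm i\rho f^2$ and $-\sigma f^3$ are imaginary and drop out of the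
    -- real part.
    change (conj (-2 * (c * (f ^ 3 * z))) * (c * (f * n))).re
      = 2 * ((c * f ^ 2 * (n + Complex.I * ρ * (f ^ 2 * z) + -σ * (f ^ 3 * z)))
        * conj (c * f ^ 2 * z)).re
    apply Complex.ofReal_injective
    push_cast
    simp only [Complex.re_eq_add_conj, map_mul, map_add, map_neg, map_pow, hc, hf, Complex.conj_I,
      Complex.conj_ofReal, Complex.conj_conj, Complex.conj_ofNat]
    ring

/-- The slope of $B$ is an $L^2$ pairing of the slope of $w$ with $C(s)$; both factors converge in
$L^2$. -/
theorem hasDerivWithinAt_of_integral_mul {B : ℝ → ℝ} {C : ℝ → C(AddCircle L, ℂ)}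
    {w : ℝ → L2per L} {v : L2per L} {S : Set ℝ} {t : ℝ}
    (hC : ContinuousWithinAt C S t) (hw : HasDerivWithinAt w v S t)
    (hB : ∀ s ∈ S, B s - B t = (∫ x : AddCircle L, (w s - w t : L2per L) x * C s x).re) :
    HasDerivWithinAt B (∫ x : AddCircle L, v x * C t x).re S t := by
  have e : ∀ (f : L2per L) (c : C(AddCircle L, ℂ)),
      ∫ x : AddCircle L, f x * c x = inner ℂ (toL2 L (star c)) f := fun f c => by
    rw [inner_toL2]; simp
  rw [e]
  simp only [e] at hB
  rw [hasDerivWithinAt_iff_tendsto_slope] at hw ⊢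
  have h1 : Filter.Tendsto (fun s => toL2 L (star (C s))) (nhdsWithin t (S \ {t}))
      (nhds (toL2 L (star (C t)))) :=
    (((toL2 L).continuous.comp continuous_star).tendsto (C t)).comp
      (hC.mono_left (nhdsWithin_mono _ sdiff_subset))
  refine ((Complex.continuous_re.tendsto _).comp (h1.inner hw)).congr' ?_
  filter_upwards [self_mem_nhdsWithin] with s hs
  simp only [Function.comp_apply]
  rw [slope_def_module, slope_def_module, hB s hs.1, inner_smul_right_eq_smul,
    Complex.smul_re]

/-! ### The quartic terms of `J₁` -/

theorem integrable_continuousMap (F : C(AddCircle L, ℂ)) : Integrable fun x => F x :=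
  F.continuous.integrable_of_hasCompactSupport (.of_compactSpace _)

theorem integral_map_sub (F G : C(AddCircle L, ℂ)) :
    ∫ x, (F - G) x = (∫ x, F x) - ∫ x, G x :=
  integral_sub (integrable_continuousMap F) (integrable_continuousMap G)

theorem re_integral {f : AddCircle L → ℂ} (hf : Integrable f) :
    (∫ x, f x).re = ∫ x, (f x).re :=
  (Complex.reCLM.integral_comp_comm hf).symm

theorem HasACDeriv.re_integral_eq_zero {F f h : AddCircle L → ℂ} (hF : HasACDeriv F f)
    (hh : Integrable h) (e : ∀ᵐ x, (h x).re = (f x).re) : (∫ x, h x).re = 0 := by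
  rw [re_integral hh, integral_congr_ae e, ← re_integral hF.integrable, hF.integral_eq_zero,
    Complex.zero_re]

theorem wd_zero_ae (φ : Hper L 3) : wd 0 φ =ᵐ[volume] rep 0 φ := wd_ae_eq_rep 0 φ
theorem wd_one_ae (φ : Hper L 3) : wd 1 φ =ᵐ[volume] rep 1 φ := wd_ae_eq_rep 1 φ
theorem wd_two_ae (φ : Hper L 3) : wd 2 φ =ᵐ[volume] rep 2 φ := wd_ae_eq_rep 2 φ

theorem hasACDeriv_rep_zero (φ : Hper L 3) : HasACDeriv (rep 0 φ) (rep 1 φ) :=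
  hasACDeriv_rep_rep (m := 1) 0 φ
theorem hasACDeriv_rep_one (φ : Hper L 3) : HasACDeriv (rep 1 φ) (rep 2 φ) :=
  hasACDeriv_rep_rep (m := 1) 1 φ
theorem hasACDeriv_rep_two (φ : Hper L 3) : HasACDeriv (rep 2 φ) (wd 3 φ) :=
  hasACDeriv_rep 2 φ

/-- The difference of `∫ |φ|²|φ_x|²` at `φ` and `ψ` is the real part of the integral of `φ - ψ`
against this function. -/
def modKernel (φ ψ : Hper L 3) : C(AddCircle L, ℂ) :=
  star (rep 0 φ + rep 0 ψ) * (rep 1 φ * star (rep 1 φ))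
    - ((rep 1 ψ * star (rep 0 ψ) + rep 0 ψ * star (rep 1 ψ)) * star (rep 1 φ + rep 1 ψ)
      + rep 0 ψ * star (rep 0 ψ) * star (rep 2 φ + rep 2 ψ))

/-- The difference of `Re ∫ φ² (conj φ_x)²` at `φ` and `ψ` is the real part of the integral of
`φ - ψ` against this function. -/
def phaseKernel (φ ψ : Hper L 3) : C(AddCircle L, ℂ) :=
  (rep 0 φ + rep 0 ψ) * star (rep 1 φ) ^ 2
    - (2 * star (rep 0 ψ) * star (rep 1 ψ) * (rep 1 φ + rep 1 ψ)
      + star (rep 0 ψ) ^ 2 * (rep 2 φ + rep 2 ψ))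

theorem continuous_modKernel (ψ : Hper L 3) : Continuous fun φ => modKernel φ ψ := by
  have h0 := continuous_rep (L := L) (m := 2) 0
  have h1 := continuous_rep (L := L) (m := 2) 1
  have h2 := continuous_rep (L := L) (m := 2) 2
  unfold modKernel
  fun_prop

theorem continuous_phaseKernel (ψ : Hper L 3) : Continuous fun φ => phaseKernel φ ψ := by
  have h0 := continuous_rep (L := L) (m := 2) 0
  have h1 := continuous_rep (L := L) (m := 2) 1
  have h2 := continuous_rep (L := L) (m := 2) 2
  unfold phaseKernel
  fun_prop

theorem wd_sub_ae (φ ψ : Hper L 3) :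
    (wd 0 φ - wd 0 ψ : L2per L) =ᵐ[volume] fun x => rep 0 φ x - rep 0 ψ x := by
  filter_upwards [Lp.coeFn_sub (wd 0 φ) (wd 0 ψ), wd_zero_ae φ, wd_zero_ae ψ] with x h h1 h2
  rw [h, Pi.sub_apply, h1, h2]

theorem ofReal_norm_sq (z : ℂ) : ((‖z‖ : ℝ) : ℂ) ^ 2 = z * conj z := (Complex.mul_conj' z).symm

/-- Write the difference as $(|\phi|^2-|\psi|^2)|\phi_x|^2+|\psi|^2(|\phi_x|^2-|\psi_x|^2)$ and use
$|a|^2-|b|^2=\mathrm{Re}\,(a-b)\overline{(a+b)}$. In the second term the derivative is then moved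
off $\phi_x-\psi_x$; `D` is the corresponding exact derivative. -/
theorem integral_mod_sub (φ ψ : Hper L 3) :
    (∫ x : AddCircle L, ‖wd 0 φ x‖ ^ 2 * ‖wd 1 φ x‖ ^ 2)
      - (∫ x : AddCircle L, ‖wd 0 ψ x‖ ^ 2 * ‖wd 1 ψ x‖ ^ 2)
      = (∫ x : AddCircle L, (wd 0 φ - wd 0 ψ : L2per L) x * modKernel φ ψ x).re := by
  have a := hasACDeriv_rep_zero φ
  have b := hasACDeriv_rep_zero ψ
  have a' := hasACDeriv_rep_one φ
  have b' := hasACDeriv_rep_one ψ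
  have D := (a.add (b.const_mul (-1))).mul ((b.mul b.star).mul (a'.add b').star)
  have hI : ∀ χ : Hper L 3, (∫ x : AddCircle L, ‖wd 0 χ x‖ ^ 2 * ‖wd 1 χ x‖ ^ 2)
      = (∫ x : AddCircle L, (rep 0 χ * star (rep 0 χ) * (rep 1 χ * star (rep 1 χ))) x).re := by
    intro χ
    rw [← Complex.ofReal_re (∫ x : AddCircle L, ‖wd 0 χ x‖ ^ 2 * ‖wd 1 χ x‖ ^ 2),
      ← integral_complex_ofReal]
    congr 1
    refine integral_congr_ae ?_
    filter_upwards [wd_zero_ae χ, wd_one_ae χ] with x h0 h1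
    simp [h0, h1, ofReal_norm_sq]
  have hK : ∫ x : AddCircle L, (wd 0 φ - wd 0 ψ : L2per L) x * modKernel φ ψ x
      = ∫ x : AddCircle L, ((rep 0 φ - rep 0 ψ) * modKernel φ ψ) x := by
    refine integral_congr_ae ?_
    filter_upwards [wd_sub_ae φ ψ] with x hx
    rw [hx, ContinuousMap.mul_apply, ContinuousMap.sub_apply]
  rw [hI, hI, hK, ← sub_eq_zero, ← Complex.sub_re, ← Complex.sub_re, ← integral_map_sub,
    ← integral_map_sub]
  refine D.re_integral_eq_zero (integrable_continuousMap _) (.of_forall fun x => ?_)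
  apply Complex.ofReal_injective
  simp only [modKernel, ContinuousMap.mul_apply, ContinuousMap.sub_apply, ContinuousMap.add_apply,
    ContinuousMap.star_apply, RCLike.star_def, Complex.re_eq_add_conj, map_mul, map_add, map_sub,
    map_neg, map_one, Complex.conj_conj]
  ring

theorem integral_phase_sub (φ ψ : Hper L 3) :
    (∫ x : AddCircle L, wd 0 φ x ^ 2 * conj (wd 1 φ x) ^ 2).re
      - (∫ x : AddCircle L, wd 0 ψ x ^ 2 * conj (wd 1 ψ x) ^ 2).re
      = (∫ x : AddCircle L, (wd 0 φ - wd 0 ψ : L2per L) x * phaseKernel φ ψ x).re := by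
  have a := hasACDeriv_rep_zero φ
  have b := hasACDeriv_rep_zero ψ
  have a' := hasACDeriv_rep_one φ
  have b' := hasACDeriv_rep_one ψ
  -- The term $\psi^2(\overline\phi_x^2-\overline\psi_x^2)$ is conjugated under the real part, so
  -- that $\phi-\psi$ appears unconjugated before integrating by parts.
  have D := (a.add (b.const_mul (-1))).mul ((b.star.mul b.star).mul (a'.add b'))
  have hI : ∀ χ : Hper L 3, (∫ x : AddCircle L, wd 0 χ x ^ 2 * conj (wd 1 χ x) ^ 2)
      = ∫ x : AddCircle L, (rep 0 χ ^ 2 * star (rep 1 χ) ^ 2) x := by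
    intro χ
    refine integral_congr_ae ?_
    filter_upwards [wd_zero_ae χ, wd_one_ae χ] with x h0 h1
    simp [h0, h1]
  have hK : ∫ x : AddCircle L, (wd 0 φ - wd 0 ψ : L2per L) x * phaseKernel φ ψ x
      = ∫ x : AddCircle L, ((rep 0 φ - rep 0 ψ) * phaseKernel φ ψ) x := by
    refine integral_congr_ae ?_
    filter_upwards [wd_sub_ae φ ψ] with x hx
    rw [hx, ContinuousMap.mul_apply, ContinuousMap.sub_apply]
  rw [hI, hI, hK, ← sub_eq_zero, ← Complex.sub_re, ← Complex.sub_re, ← integral_map_sub,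
    ← integral_map_sub]
  refine D.re_integral_eq_zero (integrable_continuousMap _) (.of_forall fun x => ?_)
  apply Complex.ofReal_injective
  have h2 : (2 : C(AddCircle L, ℂ)) x = 2 := rfl
  simp only [phaseKernel, ContinuousMap.mul_apply, ContinuousMap.sub_apply, ContinuousMap.add_apply,
    ContinuousMap.pow_apply, h2,
    ContinuousMap.star_apply, RCLike.star_def, Complex.re_eq_add_conj, map_mul, map_add, map_sub,
    map_neg, map_one, map_pow, Complex.conj_conj, Complex.conj_ofNat]
  ring

/-! ### The nonlinearity -/

/-- The nonlinear part `-3α|φ|²φ_x + iδ|φ|²φ` of `φ_t`. -/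
def nonlin (α δ : ℝ) (φ : Hper L 3) : C(AddCircle L, ℂ) :=
  (-3 * α : ℂ) • (rep 0 φ * star (rep 0 φ) * rep 1 φ)
    + (Complex.I * δ) • (rep 0 φ * star (rep 0 φ) * rep 0 φ)

/-- The derivative of `nonlin` with respect to `x`. -/
def nonlinDeriv (α δ : ℝ) (φ : Hper L 3) : C(AddCircle L, ℂ) :=
  (-3 * α : ℂ) • ((rep 1 φ * star (rep 0 φ) + rep 0 φ * star (rep 1 φ)) * rep 1 φ
      + rep 0 φ * star (rep 0 φ) * rep 2 φ)
    + (Complex.I * δ) • ((rep 1 φ * star (rep 0 φ) + rep 0 φ * star (rep 1 φ)) * rep 0 φ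
      + rep 0 φ * star (rep 0 φ) * rep 1 φ)

theorem hasACDeriv_nonlin (α δ : ℝ) (φ : Hper L 3) :
    HasACDeriv (nonlin α δ φ) (nonlinDeriv α δ φ) := by
  have a := hasACDeriv_rep_zero φ
  have b := hasACDeriv_rep_one φ
  exact ((((a.mul a.star).mul b).const_mul (-3 * α : ℂ)).add
    (((a.mul a.star).mul a).const_mul (Complex.I * δ))).congr (fun _ => rfl) (fun _ => rfl)

theorem continuous_nonlinDeriv (α δ : ℝ) :
    Continuous (nonlinDeriv α δ : Hper L 3 → C(AddCircle L, ℂ)) := by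
  have h0 := continuous_rep (L := L) (m := 2) 0
  have h1 := continuous_rep (L := L) (m := 2) 1
  have h2 := continuous_rep (L := L) (m := 2) 2
  unfold nonlinDeriv
  fun_prop

/-- The right-hand side of the equation solved for `φ_t`. -/
def timeDeriv (α ρ σ δ : ℝ) (φ : Hper L 3) : L2per L :=
  toL2 L (nonlin α δ φ) + (Complex.I * ρ) • wd 2 φ + (-σ : ℂ) • wd 3 φ

theorem timeDeriv_ae (α ρ σ δ : ℝ) (φ : Hper L 3) :
    ∀ᵐ x : AddCircle L, timeDeriv α ρ σ δ φ x
      = nonlin α δ φ x + Complex.I * ρ * rep 2 φ x - σ * wd 3 φ x := by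
  filter_upwards [Lp.coeFn_add (toL2 L (nonlin α δ φ) + (Complex.I * ρ) • wd 2 φ)
      ((-σ : ℂ) • wd 3 φ), Lp.coeFn_add (toL2 L (nonlin α δ φ)) ((Complex.I * ρ) • wd 2 φ),
    Lp.coeFn_smul (Complex.I * ρ) (wd 2 φ), Lp.coeFn_smul (-σ : ℂ) (wd 3 φ),
    coeFn_toL2 (nonlin α δ φ), wd_two_ae φ] with x h1 h2 h3 h4 h5 h6
  rw [timeDeriv, h1, Pi.add_apply, h2, Pi.add_apply, h3, h4, h5, Pi.smul_apply, Pi.smul_apply, h6]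
  simp only [smul_eq_mul]; ring

theorem IsSolution.hasDerivWithinAt {α ρ σ δ : ℝ} {φ₀ : Hper L 3} {T : ℝ} {φ : ℝ → Hper L 3}
    (hφ : IsSolution α ρ σ δ φ₀ T φ) {t : ℝ} (ht : t ∈ Icc 0 T) :
    HasDerivWithinAt (fun s => wd 0 (φ s)) (timeDeriv α ρ σ δ (φ t)) (Icc 0 T) t := by
  have h := ((hφ.contDiffOn.differentiableOn (by norm_num)) t ht).hasDerivWithinAt
  convert! h using 1
  apply Lp.ext
  filter_upwards [hφ.equation t ht, timeDeriv_ae α ρ σ δ (φ t), wd_zero_ae (φ t),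
    wd_one_ae (φ t), wd_two_ae (φ t)] with x h1 h2 h3 h4 h5
  rw [h2]
  rw [h3, h4, h5, ofReal_norm_sq] at h1
  simp only [nonlin, ContinuousMap.mul_apply, ContinuousMap.add_apply, ContinuousMap.smul_apply,
    ContinuousMap.star_apply, RCLike.star_def, smul_eq_mul]
  linear_combination -h1

theorem IsSolution.hasDerivWithinAt_J₁ {α ρ σ δ : ℝ} {φ₀ : Hper L 3} {T : ℝ} {φ : ℝ → Hper L 3}
    (hφ : IsSolution α ρ σ δ φ₀ T φ) {t : ℝ} (ht : t ∈ Icc 0 T) :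
    HasDerivWithinAt (fun s => J₁ ρ δ (φ s))
      (ρ * (-2 * (∫ x : AddCircle L, nonlinDeriv α δ (φ t) x * conj (wd 3 (φ t) x)).re)
        - 4 * δ * (∫ x : AddCircle L,
          timeDeriv α ρ σ δ (φ t) x * modKernel (φ t) (φ t) x).re
        - δ * (∫ x : AddCircle L,
          timeDeriv α ρ σ δ (φ t) x * phaseKernel (φ t) (φ t) x).re) (Icc 0 T) t := by
  have h1 := hasDerivWithinAt_integral_sq_wd_two (N := fun t => nonlin α δ (φ t)) hφ.continuousOn
    ((continuous_nonlinDeriv α δ).comp_continuousOn hφ.continuousOn)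
    (fun s => hasACDeriv_nonlin α δ (φ s)) (fun s hs => hφ.hasDerivWithinAt hs) t ht
  -- The second argument is frozen at $\phi(t)$; only the first moves with $s$.
  have h2 := hasDerivWithinAt_of_integral_mul (C := fun s => modKernel (φ s) (φ t))
    ((continuous_modKernel (φ t)).continuousAt.comp_continuousWithinAt (hφ.continuousOn t ht))
    (hφ.hasDerivWithinAt ht) (fun s _ => integral_mod_sub (φ s) (φ t))
  have h3 := hasDerivWithinAt_of_integral_mul (C := fun s => phaseKernel (φ s) (φ t))
    ((continuous_phaseKernel (φ t)).continuousAt.comp_continuousWithinAt (hφ.continuousOn t ht))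
    (hφ.hasDerivWithinAt ht) (fun s _ => integral_phase_sub (φ s) (φ t))
  exact ((h1.const_mul ρ).sub (h2.const_mul (4 * δ))).sub (h3.const_mul δ)

/-! ### The energy identity -/

/-- `f` is integrable with integral `a`. -/
def HasIntegral (f : AddCircle L → ℂ) (a : ℂ) : Prop :=
  Integrable f ∧ ∫ x, f x = a

namespace HasIntegral

variable {f g : AddCircle L → ℂ} {a b : ℂ}

theorem add (hf : HasIntegral f a) (hg : HasIntegral g b) :
    HasIntegral (fun x => f x + g x) (a + b) :=
  ⟨hf.1.add hg.1, by rw [integral_add hf.1 hg.1, hf.2, hg.2]⟩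

theorem sub (hf : HasIntegral f a) (hg : HasIntegral g b) :
    HasIntegral (fun x => f x - g x) (a - b) :=
  ⟨hf.1.sub hg.1, by rw [integral_sub hf.1 hg.1, hf.2, hg.2]⟩

theorem const_mul (c : ℂ) (hf : HasIntegral f a) : HasIntegral (fun x => c * f x) (c * a) :=
  ⟨hf.1.const_mul c, by rw [integral_const_mul, hf.2]⟩

end HasIntegral

theorem integrable_of_ae_eq_rep {f : AddCircle L → ℂ} (φ : Hper L 3) (F : C(AddCircle L, ℂ))
    (h : ∀ x, wd 0 φ x = rep 0 φ x → wd 1 φ x = rep 1 φ x → wd 2 φ x = rep 2 φ x → f x = F x) :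
    Integrable f := by
  refine (integrable_continuousMap F).congr ?_
  filter_upwards [wd_zero_ae φ, wd_one_ae φ, wd_two_ae φ] with x h0 h1 h2
  exact (h x h0 h1 h2).symm

theorem energy_identity {α ρ σ δ : ℝ} (hbal : α * ρ = σ * δ) (φ : Hper L 3) :
    ρ * (-2 * (∫ x : AddCircle L, nonlinDeriv α δ φ x * conj (wd 3 φ x)).re)
        - 4 * δ * (∫ x : AddCircle L, timeDeriv α ρ σ δ φ x * modKernel φ φ x).re
        - δ * (∫ x : AddCircle L, timeDeriv α ρ σ δ φ x * phaseKernel φ φ x).re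
      = E₁ α ρ δ φ := by
  have hbalC : (α : ℂ) * ρ = σ * δ := by exact_mod_cast hbal
  have iA : Integrable fun x : AddCircle L => nonlinDeriv α δ φ x * conj (wd 3 φ x) := by
    simpa only [mul_comm] using HasACDeriv.integrable_mul_continuous
      (hasACDeriv_rep_two φ).star.integrable (nonlinDeriv α δ φ).continuous
  have iB : Integrable fun x : AddCircle L => timeDeriv α ρ σ δ φ x * modKernel φ φ x :=
    HasACDeriv.integrable_mul_continuous (integrable_coe _) (modKernel φ φ).continuous
  have iC : Integrable fun x : AddCircle L => timeDeriv α ρ σ δ φ x * phaseKernel φ φ x :=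
    HasACDeriv.integrable_mul_continuous (integrable_coe _) (phaseKernel φ φ).continuous
  set u : C(AddCircle L, ℂ) := rep 0 φ with hu
  set v : C(AddCircle L, ℂ) := rep 1 φ with hv
  set w : C(AddCircle L, ℂ) := rep 2 φ with hw
  have n4 : ∀ z : ℂ, ((‖z‖ : ℝ) : ℂ) ^ 4 = (z * conj z) ^ 2 := fun z => by
    rw [← ofReal_norm_sq]; ring
  have i1 : Integrable fun x : AddCircle L => ((‖wd 0 φ x‖ ^ 2 * ‖wd 1 φ x‖ ^ 2
      * (2 * (conj (wd 0 φ x) * wd 1 φ x).re) : ℝ) : ℂ) :=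
    integrable_of_ae_eq_rep φ (u * star u * (v * star v) * (star u * v + u * star v))
      fun x h0 h1 _ => by
        simp only [Complex.ofReal_mul, Complex.ofReal_pow, Complex.ofReal_ofNat]
        rw [h0, h1, ofReal_norm_sq, ofReal_norm_sq, Complex.re_eq_add_conj]
        simp only [ContinuousMap.mul_apply, ContinuousMap.add_apply, ContinuousMap.star_apply,
          RCLike.star_def, map_mul, Complex.conj_conj]
        ring
  have i2 : Integrable fun x : AddCircle L =>
      (‖wd 0 φ x‖ : ℂ) ^ 2 * wd 1 φ x * conj (wd 0 φ x) ^ 2 * wd 2 φ x :=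
    integrable_of_ae_eq_rep φ (u * star u * v * star u ^ 2 * w) fun x h0 h1 h2 => by
      simp [h0, h1, h2, ofReal_norm_sq, u, v, w]
  have i3 : Integrable fun x : AddCircle L =>
      (‖wd 1 φ x‖ : ℂ) ^ 2 * wd 0 φ x * conj (wd 2 φ x) :=
    integrable_of_ae_eq_rep φ (v * star v * u * star w) fun x h0 h1 h2 => by
      simp [h0, h1, h2, ofReal_norm_sq, u, v, w]
  have i4 : Integrable fun x : AddCircle L =>
      (‖wd 1 φ x‖ : ℂ) ^ 2 * conj (wd 0 φ x) * wd 2 φ x :=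
    integrable_of_ae_eq_rep φ (v * star v * star u * w) fun x h0 h1 h2 => by
      simp [h0, h1, h2, ofReal_norm_sq, u, v, w]
  have i5 : Integrable fun x : AddCircle L => conj (wd 1 φ x) ^ 2 * wd 0 φ x * wd 2 φ x :=
    integrable_of_ae_eq_rep φ (star v ^ 2 * u * w) fun x h0 h1 h2 => by
      simp [h0, h1, h2, u, v, w]
  have i6 : Integrable fun x : AddCircle L =>
      (‖wd 0 φ x‖ : ℂ) ^ 4 * conj (wd 0 φ x) * wd 2 φ x :=
    integrable_of_ae_eq_rep φ ((u * star u) ^ 2 * star u * w) fun x h0 h1 h2 => by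
      simp [h0, h2, n4, u, w]
  have i7 : Integrable fun x : AddCircle L =>
      (‖wd 0 φ x‖ : ℂ) ^ 2 * wd 0 φ x ^ 2 * conj (wd 1 φ x) ^ 2 :=
    integrable_of_ae_eq_rep φ (u * star u * u ^ 2 * star v ^ 2) fun x h0 h1 h2 => by
      simp [h0, h1, ofReal_norm_sq, u, v]
  -- The left side minus $E_1$ as the real part of one integral; imaginary parts enter through
  -- $\mathrm{Im}\,z=\mathrm{Re}(-\mathrm iz)$.
  have H := ((((((((HasIntegral.const_mul (-2 * ρ) ⟨iA, rfl⟩).sub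
    (.const_mul (4 * δ) ⟨iB, rfl⟩)).sub (.const_mul δ ⟨iC, rfl⟩)).sub
    (.const_mul (9 * α * δ) ⟨i1, integral_complex_ofReal⟩)).add
    (.const_mul (6 * α * δ) ⟨i2, rfl⟩)).add
    ((HasIntegral.const_mul (8 * δ * ρ * -Complex.I) ⟨i3, rfl⟩).add
      (.const_mul (4 * δ * ρ * -Complex.I) ⟨i4, rfl⟩))).add
    (.const_mul (2 * δ * ρ * -Complex.I) ⟨i5, rfl⟩)).sub
    (.const_mul (6 * δ ^ 2 * -Complex.I) ⟨i6, rfl⟩)).add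
    (.const_mul (6 * δ ^ 2 * -Complex.I) ⟨i7, rfl⟩)
  have a : HasACDeriv u v := hasACDeriv_rep_zero φ
  have b : HasACDeriv v w := hasACDeriv_rep_one φ
  have c : HasACDeriv w (wd 3 φ) := hasACDeriv_rep_two φ
  -- With $u,v,w=\phi,\phi_x,\phi_{xx}$, the potential is $\sigma\delta(-u^2\bar w^2+2|v|^2u\bar
  -- w-|u|^2|w|^2-\tfrac12|v|^4)-12\alpha\delta|u|^4|v|^2-2\mathrm i\delta\rho\,(u^2\bar v\bar
  -- w+2|u|^2v\bar w)$. The $\delta\rho$ part removes $\overline\phi_{xxx}$ from the contribution of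
  -- $\mathrm i\delta|\phi|^2\phi$ to $N_x$.
  have D := ((((((a.mul a).mul (c.mul c).star).const_mul (-1)).add
      (((a.mul b).mul (b.mul c).star).const_mul 2)).add
      ((((a.mul c).mul (a.mul c).star).const_mul (-1)).add
      (((b.mul b).mul (b.mul b).star).const_mul (-1 / 2)))).const_mul (σ * δ)).add
    (((((a.mul a).mul b).mul ((a.mul a).mul b).star).const_mul (-12 * (α * δ))).add
    ((((a.mul a).mul (b.mul c).star).const_mul (-2 * Complex.I * (δ * ρ))).add
      (((a.mul b).mul (a.mul c).star).const_mul (-4 * Complex.I * (δ * ρ)))))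
  have key := D.re_integral_eq_zero H.1 ?_
  · rw [H.2] at key
    rw [← sub_eq_zero, ← key, E₁]
    simp only [Complex.add_re, Complex.sub_re, Complex.mul_re, Complex.mul_im, Complex.neg_re,
      Complex.neg_im, Complex.ofReal_re, Complex.ofReal_im, Complex.I_re, Complex.I_im,
      Complex.re_ofNat, Complex.im_ofNat, ← Complex.ofReal_pow]
    ring
  · filter_upwards [timeDeriv_ae α ρ σ δ φ, wd_zero_ae φ, wd_one_ae φ, wd_two_ae φ]
      with x ht h0 h1 h2
    have ht2 : (2 : C(AddCircle L, ℂ)) x = 2 := rfl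
    apply Complex.ofReal_injective
    simp only [Complex.ofReal_mul, Complex.ofReal_pow, Complex.ofReal_ofNat]
    rw [ht]
    simp only [h0, h1, h2, ofReal_norm_sq, n4, nonlin, nonlinDeriv, modKernel, phaseKernel,
      ← hu, ← hv, ← hw, ContinuousMap.mul_apply, ContinuousMap.sub_apply, ContinuousMap.add_apply,
      ContinuousMap.smul_apply, smul_eq_mul, ContinuousMap.pow_apply, ht2,
      ContinuousMap.star_apply, RCLike.star_def, Complex.re_eq_add_conj, map_mul, map_add, map_sub,
      map_neg, map_one, map_pow, map_div₀, Complex.conj_conj, Complex.conj_ofNat, Complex.conj_I,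
      Complex.conj_ofReal]
    generalize conj (wd 3 φ x) = z'
    generalize wd 3 φ x = z
    generalize conj (u x) = u'
    generalize conj (v x) = v'
    generalize conj (w x) = w'
    generalize u x = u
    generalize v x = v
    generalize w x = w
    -- The balance replaces $\alpha\rho$ by $\sigma\delta$ in the product of $\overline\phi_{xxx}$
    -- with the $\alpha$-part of $N_x$ and in its conjugate. The rest is a polynomial identity in
    -- values and conjugates taken as independent variables.
    linear_combination (3 * (z' * ((v * u' + u * v') * v + u * u' * w)
      + z * ((v' * u + u' * v) * v' + u * u' * w'))) * hbalC

end ENLS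

end

theorem lemma2p4 (L : ℝ) [Fact (0 < L)] (α ρ σ δ : ℝ) (hbal : α * ρ = σ * δ)
    (φ₀ : ENLS.Hper L 3) (T : ℝ) (hT : 0 < T) (φ : ℝ → ENLS.Hper L 3)
    (hφ : ENLS.IsSolution α ρ σ δ φ₀ T φ) :
    ∀ t ∈ Set.Icc 0 T,
      HasDerivWithinAt (fun s => ENLS.J₁ ρ δ (φ s)) (ENLS.E₁ α ρ δ (φ t)) (Set.Icc 0 T) t := by
  intro t ht
  rw [← ENLS.energy_identity hbal (φ t)]
  exact hφ.hasDerivWithinAt_J₁ ht
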